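/- Let $(X,d)$ be a Hadamard space, that is, a complete CAT(0) space, and let $A \subset X$ be a nonempty finite set. A set $C \subset X$ is convex if it contains every geodesic segment between any two of its points; the convex hull of $A$ is the intersection of all convex sets containing $A$, and the closed convex hull $\mathrm{cl}\,\mathrm{conv}(A)$ is the closure of the convex hull. Let $\Delta^A$ be the set of vectors $w \in \mathbb{R}^A$ with nonnegative components satisfying $\sum_{a \in A} w_a = 1$. A point $\bar x \in X$ is a barycenter of $A$ if for some $w \in \Delta^A$ it minimizes the function $x \mapsto \sum_{a \in A} w_a\, d(a,x)^2$ over $X$; the mean set $\mathrm{mean}(A)$ is the set of all barycenters of $A$. A point $\bar x \in X$ is called - strongly $A$-minimal if no point $x \neq \bar x$ satisfies $d(a,x) \le d(a,\bar x)$ for all $a \in A$; - $A$-Pareto if every point $x \in X$ with $d(a,x) \le d(a,\bar x)$ for all $a \in A$ satisfies $d(a,x) = d(a,\bar x)$ for all $a \in A$; - $A$-minimal if no point $x \in X$ satisfies $d(a,x) < d(a,\bar x)$ for all $a \in A$. Then $\mathrm{mean}(A)$ is nonempty, compact and path-connected, it is contained in $\mathrm{cl}\,\mathrm{conv}(A)$,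 and it coincides with the set of strongly $A$-minimal points, with the set of $A$-Pareto points, and with the set of $A$-minimal points. -/

import Mathlib

namespace HadamardMean

section Geometry

variable {X : Type*} [MetricSpace X]

/-- `S` is a geodesic segment joining `x` to `y`: the image of the interval `[0, d(x, y)]` under an
isometric map sending the left endpoint to `x` and the right endpoint to `y`. -/
def IsGeodesicSegment (x y : X) (S : Set X) : Prop :=
  ∃ γ : ℝ → X, γ 0 = x ∧ γ (dist x y) = y ∧
    (∀ s ∈ Set.Icc 0 (dist x y), ∀ t ∈ Set.Icc 0 (dist x y), dist (γ s) (γ t) = |s - t|) ∧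
    S = γ '' Set.Icc 0 (dist x y)

/-- A subset is (geodesically) convex if it contains every geodesic segment between its points. -/
def IsGeodesicallyConvex (C : Set X) : Prop :=
  ∀ x ∈ C, ∀ y ∈ C, ∀ S : Set X, IsGeodesicSegment x y S → S ⊆ C

/-- The convex hull: the intersection of all convex sets containing `S`. -/
def geodesicConvexHull (S : Set X) : Set X :=
  ⋂₀ {C : Set X | S ⊆ C ∧ IsGeodesicallyConvex C}

/-- The closed convex hull: the closure of the convex hull. -/
def closedGeodesicConvexHull (S : Set X) : Set X :=
  closure (geodesicConvexHull S)

/-- The Euclidean triangle `p' q' r'` in the plane has the side lengths of the triple `p q r`. -/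
def IsComparisonTriangle (p q r : X) (p' q' r' : EuclideanSpace ℝ (Fin 2)) : Prop :=
  dist p' q' = dist p q ∧ dist q' r' = dist q r ∧ dist p' r' = dist p r

variable (X)

/-- Every two points are joined by a geodesic segment. -/
def IsGeodesicSpace : Prop :=
  ∀ x y : X, ∃ S : Set X, IsGeodesicSegment x y S

/-- A CAT(0) space: a geodesic space in which, for every geodesic triangle, distances between points
on its sides are at most the distances between the corresponding points on a comparison triangle.
Two points on different sides lie, after naming the vertices, on the sides `[p, q]` and `[p, r]`
issuing from a common vertex `p`; for two points on one side the comparison is an equality. -/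
structure IsCAT0 : Prop where
  geodesic : IsGeodesicSpace X
  comparison : ∀ (p q r : X) (Spq Sqr Spr : Set X),
    IsGeodesicSegment p q Spq → IsGeodesicSegment q r Sqr → IsGeodesicSegment p r Spr →
    ∀ p' q' r' : EuclideanSpace ℝ (Fin 2), IsComparisonTriangle p q r p' q' r' →
    ∀ x ∈ Spq, ∀ y ∈ Spr, ∀ x' ∈ segment ℝ p' q', ∀ y' ∈ segment ℝ p' r',
      dist p' x' = dist p x → dist p' y' = dist p y → dist x y ≤ dist x' y'

/-- A Hadamard space is a complete CAT(0) space. -/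
structure IsHadamardSpace : Prop where
  complete : CompleteSpace X
  cat0 : IsCAT0 X

end Geometry

section Means

variable {X : Type*} [MetricSpace X]

/-- The distance vector `d_A(x) ∈ ℝ^A`. -/
noncomputable def distVec (A : Finset X) (x : X) : A → ℝ :=
  fun a => dist (a : X) x

/-- Points `z` such that no other point `x` satisfies `d_A(x) ≤ d_A(z)`. -/
def stronglyMinimalSet (A : Finset X) : Set X :=
  {z | ∀ x : X, x ≠ z → ¬ distVec A x ≤ distVec A z}

/-- Points `z` such that `d_A(x) ≤ d_A(z)` forces `d_A(x) = d_A(z)`. -/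
def paretoSet (A : Finset X) : Set X :=
  {z | ∀ x : X, distVec A x ≤ distVec A z → distVec A x = distVec A z}

/-- Points `z` such that no point is strictly closer than `z` to every point of `A`. -/
def minimalSet (A : Finset X) : Set X :=
  {z | ¬ ∃ x : X, ∀ a : A, distVec A x a < distVec A z a}

/-- `z` minimizes the weighted sum of squared distances `x ↦ ⟨w, d_A²(x)⟩`. -/
def IsBarycenterFor (A : Finset X) (w : A → ℝ) (z : X) : Prop :=
  ∀ x : X, ∑ a : A, w a * distVec A z a ^ 2 ≤ ∑ a : A, w a * distVec A x a ^ 2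

/-- The mean set: all barycenters, over all weight vectors in the simplex. -/
def meanSet (A : Finset X) : Set X :=
  {z | ∃ w ∈ stdSimplex ℝ A, IsBarycenterFor A w z}

end Means

end HadamardMean

namespace HadamardMean

open Filter Topology

/-! ### Minimizers of uniformly convex functions. -/

section Minimization

variable {X : Type*} [MetricSpace X]

/-! Squared distances in a CAT(0) space are uniformly convex along geodesics (Bruhat–Tits), so by
completeness each weighted sum has a unique minimizer with quadratic growth around it: the variance
inequality. It makes barycenters depend continuously on the weights, so the mean set is a continuous
image of the simplex, and it makes barycenters strongly minimal. Projection onto the closed hull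
moves no point farther from `A`, so barycenters lie there. Strongly minimal ⇒ Pareto ⇒ minimal is
formal. The cycle closes by Hahn–Banach: the vectors dominating some squared distance vector form a
convex set, and at a minimal point a separating functional supplies the weights. -/

/-- A continuous function that is bounded below and uniformly convex along points of `C` has a
minimizer on the closure of `C`, around which it grows at least quadratically. -/
theorem exists_quadratic_minimizer [CompleteSpace X] {C : Set X} (hC : C.Nonempty) {f : X → ℝ}
    (hf : Continuous f) (hf0 : ∀ x, 0 ≤ f x)
    (hconv : ∀ x ∈ C, ∀ y ∈ C, ∀ t ∈ Set.Icc (0 : ℝ) 1,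
      ∃ z ∈ C, f z ≤ (1 - t) * f x + t * f y - t * (1 - t) * dist x y ^ 2) :
    ∃ z ∈ closure C, ∀ y ∈ closure C, f z + dist z y ^ 2 ≤ f y := by
  have hbdd : BddBelow (f '' C) := ⟨0, by rintro _ ⟨x, -, rfl⟩; exact hf0 x⟩
  have hne : (f '' C).Nonempty := hC.image f
  set m := sInf (f '' C) with hm
  have hkey : ∀ x ∈ C, ∀ y ∈ C, ∀ t ∈ Set.Icc (0 : ℝ) 1,
      m ≤ (1 - t) * f x + t * f y - t * (1 - t) * dist x y ^ 2 := by
    intro x hx y hy t ht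
    obtain ⟨z, hz, hzle⟩ := hconv x hx y hy t ht
    exact (csInf_le hbdd ⟨z, hz, rfl⟩).trans hzle
  obtain ⟨u, -, hu, huC⟩ := exists_seq_tendsto_sInf hne hbdd
  choose c hcC hcu using huC
  have hfc : Tendsto (fun n => f (c n)) atTop (𝓝 m) := by simpa only [hcu] using hu
  have hcauchy : CauchySeq c := by
    rw [Metric.cauchySeq_iff']
    intro ε hε
    have hev : ∀ᶠ n in atTop, f (c n) < m + ε ^ 2 / 4 :=
      hfc.eventually (gt_mem_nhds (by have := pow_pos hε 2; linarith))
    obtain ⟨N, hN⟩ := eventually_atTop.1 hev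
    refine ⟨N, fun n hn => ?_⟩
    -- At the midpoint, `dist ^ 2 / 4` is at most the mean excess of `f` over `m`, which is below `ε
    -- ^ 2 / 4`.
    have h := hkey (c n) (hcC n) (c N) (hcC N) (1 / 2) ⟨by norm_num, by norm_num⟩
    have h1 := hN n hn
    have h2 := hN N le_rfl
    exact lt_of_pow_lt_pow_left₀ 2 hε.le (by nlinarith)
  obtain ⟨z, hz⟩ := cauchySeq_tendsto_of_complete hcauchy
  have hzC : z ∈ closure C := mem_closure_of_tendsto hz (Eventually.of_forall hcC)
  have hfz : f z = m := tendsto_nhds_unique ((hf.tendsto z).comp hz) hfc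
  have hlim : ∀ y ∈ closure C, ∀ t ∈ Set.Icc (0 : ℝ) 1,
      m ≤ (1 - t) * f y + t * f z - t * (1 - t) * dist y z ^ 2 := by
    intro y hy t ht
    -- `hkey` no longer mentions the intermediate point, so it is a closed condition on the pair.
    have hsub : closure C ×ˢ closure C ⊆ {q : X × X |
        m ≤ (1 - t) * f q.1 + t * f q.2 - t * (1 - t) * dist q.1 q.2 ^ 2} := by
      rw [← closure_prod_eq]
      refine closure_minimal (fun q hq => hkey q.1 hq.1 q.2 hq.2 t ht) ?_
      exact isClosed_le continuous_const (by fun_prop)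
    exact hsub (Set.mk_mem_prod hy hzC)
  refine ⟨z, hzC, fun y hy => ?_⟩
  -- Divide by `1 - t`, then let `t → 1`.
  have hlt : ∀ t ∈ Set.Ico (0 : ℝ) 1, m + t * dist z y ^ 2 ≤ f y := by
    intro t ht
    have h := hlim y hy t ⟨ht.1, ht.2.le⟩
    rw [hfz, dist_comm] at h
    have h1 : 0 < 1 - t := by linarith [ht.2]
    refine le_of_mul_le_mul_left ?_ h1
    linarith
  rw [hfz]
  have hT : Tendsto (fun t : ℝ => m + t * dist z y ^ 2) (𝓝[<] 1) (𝓝 (m + 1 * dist z y ^ 2)) :=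
    (Continuous.tendsto (by fun_prop) 1).mono_left nhdsWithin_le_nhds
  rw [one_mul] at hT
  exact le_of_tendsto hT
    (mem_of_superset (Ico_mem_nhdsLT one_pos) hlt)

end Minimization

/-! ### CAT(0) comparison and projections. -/

section Comparison

variable {X : Type*} [MetricSpace X]

/-- The Bruhat–Tits inequality: a point dividing a geodesic segment in the ratio `t : 1 - t`. -/
theorem IsCAT0.exists_mem_segment (h : IsCAT0 X) {x y : X} {S : Set X}
    (hS : IsGeodesicSegment x y S) {t : ℝ} (ht : t ∈ Set.Icc (0 : ℝ) 1) :
    ∃ z ∈ S, ∀ p : X,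
      dist p z ^ 2 ≤ (1 - t) * dist p x ^ 2 + t * dist p y ^ 2 - t * (1 - t) * dist x y ^ 2 := by
  obtain ⟨γ, h0, h1, hiso, rfl⟩ := id hS
  have hc0 : 0 ≤ dist x y := dist_nonneg
  have htc : t * dist x y ∈ Set.Icc 0 (dist x y) :=
    ⟨mul_nonneg ht.1 hc0, mul_le_of_le_one_left hc0 ht.2⟩
  have hxz : dist x (γ (t * dist x y)) = t * dist x y := by
    rw [← h0, hiso 0 ⟨le_rfl, hc0⟩ _ (by rwa [h0]), h0, zero_sub, abs_neg, abs_of_nonneg htc.1]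
  refine ⟨γ (t * dist x y), ⟨_, htc, rfl⟩, fun p => ?_⟩
  rcases hc0.eq_or_lt with hc | hc
  · have hxy : x = y := dist_eq_zero.1 hc.symm
    subst hxy
    rw [dist_self, mul_zero, h0]
    linarith
  set a := dist y p with ha
  set b := dist x p with hb
  set c := dist x y with hcdef
  have t1 : a ≤ c + b := by
    have := dist_triangle y x p; rw [dist_comm y x] at this; exact this
  have t2 : b ≤ c + a := dist_triangle x y p
  have t3 : c ≤ b + a := by
    have := dist_triangle x p y; rw [dist_comm p y] at this; exact this
  have ha0 : 0 ≤ a := dist_nonneg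
  have hb0 : 0 ≤ b := dist_nonneg
  -- Comparison triangle `(0, 0)`, `(c, 0)`, `(u, v)`: `u` comes from the law of cosines, and the
  -- triangle inequalities give `u ^ 2 ≤ b ^ 2`, so `v` exists.
  obtain ⟨u, hu⟩ : ∃ u : ℝ, 2 * c * u = b ^ 2 + c ^ 2 - a ^ 2 :=
    ⟨(b ^ 2 + c ^ 2 - a ^ 2) / (2 * c), by field_simp⟩
  have hub : u ^ 2 ≤ b ^ 2 := by
    refine sq_le_sq' ?_ ?_
    · have : 0 ≤ 2 * c * (u + b) := by nlinarith
      have := nonneg_of_mul_nonneg_right this (by positivity : 0 < 2 * c)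
      linarith
    · have : 0 ≤ 2 * c * (b - u) := by nlinarith
      have := nonneg_of_mul_nonneg_right this (by positivity : 0 < 2 * c)
      linarith
  obtain ⟨v, hv⟩ : ∃ v : ℝ, v ^ 2 = b ^ 2 - u ^ 2 :=
    ⟨√(b ^ 2 - u ^ 2), Real.sq_sqrt (by linarith)⟩
  obtain ⟨Sqr, hSqr⟩ := h.geodesic y p
  obtain ⟨Spr, hSpr⟩ := h.geodesic x p
  have hdist : ∀ (e f g k d : ℝ), 0 ≤ d → (e - g) ^ 2 + (f - k) ^ 2 = d ^ 2 →
      dist (!₂[e, f] : EuclideanSpace ℝ (Fin 2)) !₂[g, k] = d := by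
    intro e f g k d hd h
    rw [EuclideanSpace.dist_eq, Fin.sum_univ_two]
    simp only [Real.dist_eq, sq_abs]
    simpa [h] using Real.sqrt_sq hd
  have hpS : p ∈ Spr := by
    obtain ⟨δ, -, hδ, -, rfl⟩ := hSpr
    exact ⟨dist x p, ⟨dist_nonneg, le_rfl⟩, hδ⟩
  have hd : 0 ≤ (t * c - u) ^ 2 + (0 - v) ^ 2 := by positivity
  have hcmp := h.comparison x y p _ Sqr Spr hS hSqr hSpr !₂[0, 0] !₂[c, 0] !₂[u, v]
    ⟨hdist _ _ _ _ _ hc.le (by ring), hdist _ _ _ _ _ ha0 (by nlinarith),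
      hdist _ _ _ _ _ hb0 (by nlinarith)⟩
    (γ (t * c)) ⟨_, htc, rfl⟩ p hpS !₂[t * c, 0]
    (by
      rw [segment_eq_image]
      refine ⟨t, ht, ?_⟩
      ext i
      fin_cases i <;> simp)
    !₂[u, v] (right_mem_segment ℝ _ _)
    (by rw [hxz]; exact hdist _ _ _ _ _ htc.1 (by ring))
    (hdist _ _ _ _ _ hb0 (by nlinarith))
  rw [hdist (t * c) 0 u v _ (Real.sqrt_nonneg _) (Real.sq_sqrt hd).symm] at hcmp
  have hsq := pow_le_pow_left₀ dist_nonneg hcmp 2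
  rw [Real.sq_sqrt hd] at hsq
  rw [dist_comm p _, dist_comm p x, dist_comm p y]
  refine hsq.trans (le_of_eq ?_)
  linear_combination hv - t * hu

theorem isGeodesicallyConvex_geodesicConvexHull (S : Set X) :
    IsGeodesicallyConvex (geodesicConvexHull S) :=
  fun x hx y hy T hT _ hz C hC => hC.2 x (hx C hC) y (hy C hC) T hT hz

theorem subset_geodesicConvexHull (S : Set X) : S ⊆ geodesicConvexHull S :=
  fun _ hx _ hC => hC.1 hx

theorem isGeodesicallyConvex_univ : IsGeodesicallyConvex (Set.univ : Set X) :=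
  fun _ _ _ _ _ _ => Set.subset_univ _

theorem IsCAT0.exists_mem_convex (h : IsCAT0 X) {C : Set X} (hC : IsGeodesicallyConvex C)
    {x y : X} (hx : x ∈ C) (hy : y ∈ C) {t : ℝ} (ht : t ∈ Set.Icc (0 : ℝ) 1) :
    ∃ z ∈ C, ∀ p : X,
      dist p z ^ 2 ≤ (1 - t) * dist p x ^ 2 + t * dist p y ^ 2 - t * (1 - t) * dist x y ^ 2 := by
  obtain ⟨S, hS⟩ := h.geodesic x y
  obtain ⟨z, hz, hzp⟩ := h.exists_mem_segment hS ht
  exact ⟨z, hC x hx y hy S hS hz, hzp⟩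

/-- Projection onto the closure of a convex set. -/
theorem IsHadamardSpace.exists_projection (h : IsHadamardSpace X) {C : Set X}
    (hC : IsGeodesicallyConvex C) (hne : C.Nonempty) (x : X) :
    ∃ z ∈ closure C, ∀ y ∈ closure C, dist x z ^ 2 + dist z y ^ 2 ≤ dist x y ^ 2 := by
  have := h.complete
  refine exists_quadratic_minimizer hne (f := fun y => dist x y ^ 2) (by fun_prop)
    (fun y => sq_nonneg _) fun p hp q hq t ht => ?_
  obtain ⟨z, hz, hzp⟩ := h.cat0.exists_mem_convex hC hp hq ht
  exact ⟨z, hz, hzp x⟩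

end Comparison

/-! ### Barycenters and the mean set. -/

section Barycenters

variable {X : Type*} [MetricSpace X] {A : Finset X} {w : A → ℝ}

theorem IsHadamardSpace.exists_barycenter (h : IsHadamardSpace X) (hA : A.Nonempty)
    (hw : w ∈ stdSimplex ℝ A) :
    ∃ z : X, ∀ x : X,
      ∑ a : A, w a * distVec A z a ^ 2 + dist z x ^ 2 ≤ ∑ a : A, w a * distVec A x a ^ 2 := by
  have := h.complete
  obtain ⟨a₀, -⟩ := hA
  obtain ⟨z, -, hz⟩ := exists_quadratic_minimizer (C := Set.univ) ⟨a₀, trivial⟩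
    (f := fun x => ∑ a : A, w a * distVec A x a ^ 2) (by unfold distVec; fun_prop)
    (fun x => Finset.sum_nonneg fun a _ => mul_nonneg (hw.1 a) (sq_nonneg _))
    (fun p hp q hq t ht => by
      obtain ⟨z, hz, hzp⟩ := h.cat0.exists_mem_convex isGeodesicallyConvex_univ hp hq ht
      refine ⟨z, hz, (Finset.sum_le_sum fun (a : A) _ =>
        mul_le_mul_of_nonneg_left (hzp (a : X)) (hw.1 a)).trans (le_of_eq ?_)⟩
      simp only [mul_sub, mul_add, Finset.sum_add_distrib, Finset.sum_sub_distrib,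
        ← Finset.sum_mul, hw.2, Finset.mul_sum, one_mul, distVec]
      simp only [mul_left_comm])
  exact ⟨z, fun x => hz x (by simp)⟩

/-- The variance inequality. -/
theorem IsBarycenterFor.variance (h : IsHadamardSpace X) (hA : A.Nonempty)
    (hw : w ∈ stdSimplex ℝ A) {z : X} (hz : IsBarycenterFor A w z) (x : X) :
    ∑ a : A, w a * distVec A z a ^ 2 + dist z x ^ 2 ≤ ∑ a : A, w a * distVec A x a ^ 2 := by
  obtain ⟨y, hy⟩ := h.exists_barycenter hA hw
  have h1 := hy z
  have h2 := hz y
  have h3 : dist y z = 0 := pow_eq_zero_iff two_ne_zero |>.1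
    (le_antisymm (by linarith) (sq_nonneg _))
  rw [← dist_eq_zero.1 h3]
  exact hy x

/-- Barycenters are at bounded distance from the points of `A`. -/
theorem IsBarycenterFor.distVec_le (h : IsHadamardSpace X) (hw : w ∈ stdSimplex ℝ A) {z : X}
    (hz : IsBarycenterFor A w z) (a : A) : distVec A z a ≤ Metric.diam (A : Set X) := by
  have hv := hz.variance h ⟨a, a.2⟩ hw (a : X)
  have hle : ∑ b : A, w b * distVec A (a : X) b ^ 2 ≤ Metric.diam (A : Set X) ^ 2 := by
    calc _ ≤ ∑ b : A, w b * Metric.diam (A : Set X) ^ 2 :=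
          Finset.sum_le_sum fun b _ => mul_le_mul_of_nonneg_left
            (pow_le_pow_left₀ dist_nonneg
              (Metric.dist_le_diam_of_mem A.finite_toSet.isBounded b.2 a.2) 2) (hw.1 b)
      _ = _ := by rw [← Finset.sum_mul, hw.2, one_mul]
  have h0 : 0 ≤ ∑ b : A, w b * distVec A z b ^ 2 :=
    Finset.sum_nonneg fun b _ => mul_nonneg (hw.1 b) (sq_nonneg _)
  refine le_of_sq_le_sq ?_ Metric.diam_nonneg
  rw [distVec, dist_comm]
  linarith

/-- Add the variance inequalities of `y` and `z`, each tested at the other point. With `w = v` this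
is uniqueness. -/
theorem IsBarycenterFor.dist_sq_le (h : IsHadamardSpace X) (hA : A.Nonempty) {v : A → ℝ}
    (hw : w ∈ stdSimplex ℝ A) (hv : v ∈ stdSimplex ℝ A) {y z : X}
    (hy : IsBarycenterFor A w y) (hz : IsBarycenterFor A v z) :
    dist y z ^ 2 ≤ (∑ a : A, |w a - v a|) * Metric.diam (A : Set X) ^ 2 := by
  have h1 := hy.variance h hA hw z
  have h2 := hz.variance h hA hv y
  rw [dist_comm] at h2
  have hsum : ∑ a : A, (w a - v a) * (distVec A z a ^ 2 - distVec A y a ^ 2) ≤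
      ∑ a : A, |w a - v a| * Metric.diam (A : Set X) ^ 2 := by
    refine Finset.sum_le_sum fun a _ => (le_abs_self _).trans ?_
    rw [abs_mul]
    refine mul_le_mul_of_nonneg_left ?_ (abs_nonneg _)
    have e1 := pow_le_pow_left₀ dist_nonneg (hy.distVec_le h hw a) 2
    have e2 := pow_le_pow_left₀ dist_nonneg (hz.distVec_le h hv a) 2
    have e3 := sq_nonneg (distVec A y a)
    have e4 := sq_nonneg (distVec A z a)
    simp only [distVec] at *
    exact abs_le.2 ⟨by linarith, by linarith⟩
  have hexp : ∑ a : A, (w a - v a) * (distVec A z a ^ 2 - distVec A y a ^ 2) =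
      (∑ a : A, w a * distVec A z a ^ 2 - ∑ a : A, w a * distVec A y a ^ 2) -
      (∑ a : A, v a * distVec A z a ^ 2 - ∑ a : A, v a * distVec A y a ^ 2) := by
    simp only [← Finset.sum_sub_distrib]
    exact Finset.sum_congr rfl fun a _ => by ring
  rw [Finset.sum_mul]
  nlinarith [sq_nonneg (dist y z)]

/-- The mean set is a continuous image of the simplex. -/
theorem IsHadamardSpace.exists_continuousOn_image_eq_meanSet (h : IsHadamardSpace X)
    (hA : A.Nonempty) :
    ∃ b : (A → ℝ) → X, ContinuousOn b (stdSimplex ℝ A) ∧ b '' stdSimplex ℝ A = meanSet A := by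
  have hex : ∀ w : A → ℝ, ∃ z : X, w ∈ stdSimplex ℝ A → IsBarycenterFor A w z := by
    intro w
    by_cases hw : w ∈ stdSimplex ℝ A
    · obtain ⟨z, hz⟩ := h.exists_barycenter hA hw
      exact ⟨z, fun _ x => by nlinarith [hz x, sq_nonneg (dist z x)]⟩
    · exact ⟨hA.choose, fun hw' => absurd hw' hw⟩
  choose b hb using hex
  refine ⟨b, fun v hv => ?_, ?_⟩
  · have hT : Tendsto (fun w : A → ℝ => √((∑ a : A, |w a - v a|) * Metric.diam (A : Set X) ^ 2))
        (𝓝[stdSimplex ℝ A] v) (𝓝 0) := by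
      have hc : Continuous fun w : A → ℝ =>
          √((∑ a : A, |w a - v a|) * Metric.diam (A : Set X) ^ 2) := by fun_prop
      simpa using (hc.tendsto v).mono_left nhdsWithin_le_nhds
    refine tendsto_iff_dist_tendsto_zero.2 (squeeze_zero' (Eventually.of_forall fun _ => dist_nonneg)
      ?_ hT)
    filter_upwards [self_mem_nhdsWithin] with w hw
    exact Real.le_sqrt_of_sq_le ((hb w hw).dist_sq_le h hA hw hv (hb v hv))
  · ext z
    constructor
    · rintro ⟨w, hw, rfl⟩
      exact ⟨w, hw, hb w hw⟩
    · rintro ⟨w, hw, hz⟩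
      refine ⟨w, hw, dist_eq_zero.1 (pow_eq_zero_iff two_ne_zero |>.1
        (le_antisymm ?_ (sq_nonneg _)))⟩
      simpa using (hb w hw).dist_sq_le h hA hw hw hz

theorem IsHadamardSpace.meanSet_subset_closedGeodesicConvexHull (h : IsHadamardSpace X)
    (hA : A.Nonempty) : meanSet A ⊆ closedGeodesicConvexHull (A : Set X) := by
  rintro z ⟨w, hw, hz⟩
  have hsub := subset_geodesicConvexHull (A : Set X)
  -- The projection is no farther from any point of `A`, so it has no larger weighted sum and must
  -- equal `z`.
  obtain ⟨y, hy, hyz⟩ := h.exists_projection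
    (isGeodesicallyConvex_geodesicConvexHull (A : Set X)) (hA.to_set.mono hsub) z
  have hle : ∑ a : A, w a * distVec A y a ^ 2 ≤ ∑ a : A, w a * distVec A z a ^ 2 := by
    refine Finset.sum_le_sum fun a _ => mul_le_mul_of_nonneg_left ?_ (hw.1 a)
    have := hyz a (subset_closure (hsub a.2))
    rw [distVec, distVec, dist_comm _ y, dist_comm _ z]
    nlinarith [sq_nonneg (dist z y)]
  have hv := hz.variance h hA hw y
  have h0 : dist z y = 0 := pow_eq_zero_iff two_ne_zero |>.1
    (le_antisymm (by linarith) (sq_nonneg _))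
  rw [dist_eq_zero.1 h0]
  exact hy

theorem IsHadamardSpace.meanSet_subset_stronglyMinimalSet (h : IsHadamardSpace X)
    (hA : A.Nonempty) : meanSet A ⊆ stronglyMinimalSet A := by
  rintro z ⟨w, hw, hz⟩ x hxz hle
  have hs : ∑ a : A, w a * distVec A x a ^ 2 ≤ ∑ a : A, w a * distVec A z a ^ 2 :=
    Finset.sum_le_sum fun a _ =>
      mul_le_mul_of_nonneg_left (pow_le_pow_left₀ dist_nonneg (hle a) 2) (hw.1 a)
  have hv := hz.variance h hA hw x
  have h0 : dist z x = 0 := pow_eq_zero_iff two_ne_zero |>.1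
    (le_antisymm (by linarith) (sq_nonneg _))
  exact hxz (dist_eq_zero.1 h0).symm

theorem stronglyMinimalSet_subset_paretoSet : stronglyMinimalSet A ⊆ paretoSet A := by
  intro z hz x hle
  by_cases hxz : x = z
  · rw [hxz]
  · exact absurd hle (hz x hxz)

theorem paretoSet_subset_minimalSet (hA : A.Nonempty) : paretoSet A ⊆ minimalSet A := by
  rintro z hz ⟨x, hx⟩
  obtain ⟨a, ha⟩ := hA
  exact (hx ⟨a, ha⟩).ne (congrFun (hz x fun b => (hx b).le) ⟨a, ha⟩)

/-- Squared distances at a point of a geodesic are bounded by convex combinations of those at its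
ends; allowing larger vectors turns this inequality into convexity. -/
theorem IsCAT0.convex_setOf_exists_distVec_sq_le (h : IsCAT0 X) (A : Finset X) :
    Convex ℝ {v : A → ℝ | ∃ x : X, ∀ a, distVec A x a ^ 2 ≤ v a} := by
  rintro v₁ ⟨x₁, h₁⟩ v₂ ⟨x₂, h₂⟩ s t hs ht hst
  obtain ⟨z, -, hz⟩ := h.exists_mem_convex isGeodesicallyConvex_univ (Set.mem_univ x₁)
    (Set.mem_univ x₂) (t := t) ⟨ht, by linarith⟩
  obtain rfl : s = 1 - t := by linarith
  refine ⟨z, fun a => (hz a).trans ?_⟩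
  have e1 := mul_le_mul_of_nonneg_left (h₁ a) hs
  have e2 := mul_le_mul_of_nonneg_left (h₂ a) ht
  have e3 : 0 ≤ t * (1 - t) * dist x₁ x₂ ^ 2 := by positivity
  simp only [distVec, Pi.add_apply, Pi.smul_apply, smul_eq_mul] at *
  linarith

/-- Minimality of `z` makes the open orthant below its squared distance vector disjoint from that
convex set. The coefficients of a separating functional, normalized, are the weights. -/
theorem IsCAT0.minimalSet_subset_meanSet (h : IsCAT0 X) (A : Finset X) :
    minimalSet A ⊆ meanSet A := by
  classical
  intro z hz
  set U : Set (A → ℝ) := {v | ∀ a, v a < distVec A z a ^ 2} with hU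
  have hUeq : U = Set.univ.pi fun a => Set.Iio (distVec A z a ^ 2) := by
    ext v; simp [hU]
  have hUconv : Convex ℝ U := by rw [hUeq]; exact convex_pi fun a _ => convex_Iio _
  have hUopen : IsOpen U := by
    rw [hUeq]; exact isOpen_set_pi Set.finite_univ fun a _ => isOpen_Iio
  have hdisj : Disjoint U {v : A → ℝ | ∃ x : X, ∀ a, distVec A x a ^ 2 ≤ v a} := by
    rw [Set.disjoint_left]
    rintro v hv ⟨x, hx⟩
    exact hz ⟨x, fun a => lt_of_pow_lt_pow_left₀ 2 dist_nonneg ((hx a).trans_lt (hv a))⟩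
  obtain ⟨f, u, hfU, hfK⟩ := geometric_hahn_banach_open hUconv hUopen
    (h.convex_setOf_exists_distVec_sq_le A) hdisj
  set d : A → ℝ := fun a => distVec A z a ^ 2 with hd
  have hf : ∀ v : A → ℝ, f v = ∑ a, f (Pi.single a 1) * v a := by
    intro v
    conv_lhs => rw [pi_eq_sum_univ' v]
    simp [mul_comm]
  have hfd : ∀ e : A → ℝ, (∀ a, 0 < e a) → f d - f e < u := fun e he => by
    rw [← map_sub]
    exact hfU _ fun a => by simpa [hd] using he a
  have hdu : u ≤ f d := hfK d ⟨z, fun a => le_rfl⟩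
  have hpos : ∀ e : A → ℝ, (∀ a, 0 < e a) → 0 < f e := fun e he => by linarith [hfd e he]
  have hw0 : ∀ a, 0 ≤ f (Pi.single a 1) := by
    intro a
    -- Positivity is known only for strictly positive vectors, so perturb by `s • 1` and let `s →
    -- 0`.
    have hT : Tendsto (fun s : ℝ => f (Pi.single a 1 + s • (1 : A → ℝ))) (𝓝[>] 0)
        (𝓝 (f (Pi.single a 1 + (0 : ℝ) • (1 : A → ℝ)))) :=
      (Continuous.tendsto (by fun_prop) 0).mono_left nhdsWithin_le_nhds
    rw [zero_smul, add_zero] at hT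
    refine ge_of_tendsto hT ?_
    filter_upwards [self_mem_nhdsWithin] with s hs
    refine (hpos _ fun b => ?_).le
    have : 0 ≤ (Pi.single a 1 : A → ℝ) b := by
      by_cases hb : b = a
      · subst hb; simp
      · simp [hb]
    have hs' : 0 < s := hs
    simp only [Pi.add_apply, Pi.smul_apply, Pi.one_apply, smul_eq_mul, mul_one]
    linarith
  have hmin : ∀ x : X, f d ≤ f fun a => distVec A x a ^ 2 := by
    intro x
    have hT : Tendsto (fun s : ℝ => f d - f (s • (1 : A → ℝ))) (𝓝[>] 0)
        (𝓝 (f d - f ((0 : ℝ) • (1 : A → ℝ)))) :=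
      (Continuous.tendsto (by fun_prop) 0).mono_left nhdsWithin_le_nhds
    rw [zero_smul, map_zero, sub_zero] at hT
    refine (le_of_tendsto hT ?_).trans (hfK _ ⟨x, fun a => le_rfl⟩)
    filter_upwards [self_mem_nhdsWithin] with s hs
    exact (hfd _ fun a => by simpa using hs).le
  -- The sum is `f 1`.
  have hS : 0 < ∑ a, f (Pi.single a 1) := by
    have := hpos 1 fun _ => one_pos
    rw [hf] at this
    simpa using this
  refine ⟨fun a => f (Pi.single a 1) / ∑ b, f (Pi.single b 1),
    ⟨fun a => div_nonneg (hw0 a) hS.le, ?_⟩, fun x => ?_⟩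
  · rw [← Finset.sum_div, div_self hS.ne']
  · have := hmin x
    rw [hf, hf] at this
    simp only [div_mul_eq_mul_div, ← Finset.sum_div]
    exact div_le_div_of_nonneg_right this hS.le

end Barycenters

end HadamardMean

theorem mainTheorem3 {X : Type*} [MetricSpace X] (hX : HadamardMean.IsHadamardSpace X)
    (A : Finset X) (hA : A.Nonempty) :
    (HadamardMean.meanSet A).Nonempty ∧
    IsCompact (HadamardMean.meanSet A) ∧
    IsPathConnected (HadamardMean.meanSet A) ∧
    HadamardMean.meanSet A ⊆ HadamardMean.closedGeodesicConvexHull (A : Set X) ∧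
    HadamardMean.meanSet A = HadamardMean.stronglyMinimalSet A ∧
    HadamardMean.meanSet A = HadamardMean.paretoSet A ∧
    HadamardMean.meanSet A = HadamardMean.minimalSet A := by
  obtain ⟨b, hb, hbimg⟩ := hX.exists_continuousOn_image_eq_meanSet hA
  have hne : (stdSimplex ℝ A).Nonempty := by
    classical
    exact ⟨_, single_mem_stdSimplex ℝ (⟨hA.choose, hA.choose_spec⟩ : A)⟩
  have h1 := hX.meanSet_subset_stronglyMinimalSet hA
  have h2 := HadamardMean.stronglyMinimalSet_subset_paretoSet (A := A)
  have h3 := HadamardMean.paretoSet_subset_minimalSet hA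
  have h4 := hX.cat0.minimalSet_subset_meanSet A
  refine ⟨hbimg ▸ hne.image b, hbimg ▸ (isCompact_stdSimplex ℝ A).image_of_continuousOn hb,
    hbimg ▸ ((convex_stdSimplex ℝ A).isPathConnected hne).image' hb,
    hX.meanSet_subset_closedGeodesicConvexHull hA,
    h1.antisymm (h2.trans (h3.trans h4)), (h1.trans h2).antisymm (h3.trans h4),
    (h1.trans (h2.trans h3)).antisymm h4⟩
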